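/- Let $S\colon\mathbb N\to\mathbb Z$ be a simple random walk, i.e. $S(n)=\sum_{i=1}^n X_i$ with $X_1,X_2,\dots$ independent and $\mathbb P(X_i=1)=\mathbb P(X_i=-1)=\tfrac12$. For $n\in\mathbb N$ let $$\operatorname{LIS}(S|_{[0,n)})=\max\{|A| : A\subset\{0,1,\dots,n-1\},\ S(a)\le S(b)\text{ for all }a,b\in A\text{ with }a\le b\}$$ be the length of the longest (weakly) increasing subsequence of $S(0),\dots,S(n-1)$. Then for every $\varepsilon>0$, for all $n$ large enough (depending on $\varepsilon$), $$\mathbb P\left(\operatorname{LIS}(S|_{[0,n)})<\varepsilon\sqrt n\,\log_2 n\right)\le 250\,\varepsilon .$$ Consequently, for all large enough $n$, $$\mathbb E\left(\operatorname{LIS}(S|_{[0,n)})\right)\ge \tfrac1{1000}\sqrt n\,\log_2 n .$$ -/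

import Mathlib

open MeasureTheory ProbabilityTheory Filter

/-- `LIS (S|_[0,n))`: the largest cardinality of a set `A ⊆ {0, …, n-1}` on which `s` is
(weakly) increasing, i.e. `s a ≤ s b` for all `a, b ∈ A` with `a ≤ b`. -/
noncomputable def LIS {α : Type*} [Preorder α] (s : ℕ → α) (n : ℕ) : ℕ :=
  open Classical in
  ((Finset.range n).powerset.filter (fun A : Finset ℕ => MonotoneOn s (A : Set ℕ))).sup Finset.card

/-- The supremum in the definition of `LIS` is a maximum. -/
theorem isGreatest_LIS {α : Type*} [Preorder α] (s : ℕ → α) (n : ℕ) :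
    IsGreatest {k : ℕ | ∃ A : Finset ℕ, A ⊆ Finset.range n ∧
      MonotoneOn s (A : Set ℕ) ∧ A.card = k} (LIS s n) := by
  classical
  constructor
  · obtain ⟨A, hA, h⟩ := Finset.exists_mem_eq_sup
      ((Finset.range n).powerset.filter (fun A : Finset ℕ => MonotoneOn s (A : Set ℕ)))
      ⟨∅, by simp [MonotoneOn]⟩ Finset.card
    rw [Finset.mem_filter, Finset.mem_powerset] at hA
    refine ⟨A, hA.1, hA.2, ?_⟩
    rw [← h]
    unfold LIS
    congr!
  · rintro k ⟨A, h1, h2, rfl⟩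
    unfold LIS
    exact Finset.le_sup (f := Finset.card)
      (Finset.mem_filter.2 ⟨Finset.mem_powerset.2 h1, h2⟩)

/-- `S` is a simple random walk on `ℤ` (started at `0`) under `μ`: `S n` is the sum of the first
`n` terms of a sequence of independent steps, each equal to `1` or `-1` with probability `1/2`.
The steps are indexed from `0`, so `X i` is the step from time `i` to time `i + 1`. -/
def IsSimpleRandomWalk {Ω : Type*} [MeasurableSpace Ω] (S : ℕ → Ω → ℤ) (μ : Measure Ω) : Prop :=
  ∃ X : ℕ → Ω → ℤ,
    (∀ i, Measurable (X i)) ∧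
    iIndepFun X μ ∧
    (∀ i, μ {ω | X i ω = 1} = 1 / 2 ∧ μ {ω | X i ω = -1} = 1 / 2) ∧
    ∀ n ω, S n ω = ∑ i ∈ Finset.range n, X i ω

/-!
A *crossing* of height `m` is a stretch of the walk which ends `m` above its starting level and
lies strictly in between at the intermediate times. Cutting a crossing of height `2 ^ (k + 1)` at
its first and last visit to the middle level leaves two crossings of height `2 ^ k`, and between
them a loop around the middle level. Increasing subsequences of the two halves can be joined, and
all visits of the loop to the middle level can be inserted between them
(`exists_monotoneOn_of_isCrossing`). There are about `2 ^ k` such visits, so each doubling of the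
height doubles the length obtained and adds about `2 ^ k`; a crossing of height `2 ^ K` thus
carries an increasing subsequence of length of order `K * 2 ^ K`.

This is made quantitative through a Laplace transform. Give a word `w` of coin tosses that forms a
crossing the mass `2 ^ (-|w|)` times `β` to the length of its subsequence. Concatenation makes the
total mass submultiplicative (`green_conv_le`), and the total mass of the loops is bounded by a tent
function, which satisfies the one-step equations of the walk (`green_loopWeight_le`). The resulting
recursion for the mass of the crossings, with `β = exp (-2 ^ (-k))`, shows that crossings
of height `2 ^ (k + 4)` with a short subsequence have a mass so small that a union bound over all
starting times excludes them (`IsFairCoin.measureReal_exists_crossWeight_ge_le`).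

It remains to find a crossing of height `m` of order `ε √n` before time `n`. If there is none, then
the walk reflected at its running minimum stays below `m`. Since `y ^ 2 + y` grows by exactly `1` in
expectation per step of the reflected walk, its expected time below `m` is at most `m ^ 2 + m`, so
this has probability at most `(m ^ 2 + m) / n` (`IsFairCoin.measureReal_no_crossing_le`), which
is of order `ε ^ 2`. The bound on the expectation is Markov's inequality for `ε = 1 / 500`.
-/

namespace CoinWalk

/-! ### Averages over words of coin tosses -/

/-- The step `±1` of the walk encoded by a coin toss. -/
def step (b : Bool) : ℤ := if b then 1 else -1

/-- The position at time `n` of the walk started at `0` and driven by the tosses `b`. -/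
def height (b : ℕ → Bool) (n : ℕ) : ℤ := ∑ i ∈ Finset.range n, step (b i)

/-- The word of the `l` tosses `b s, …, b (s + l - 1)`. -/
def word (b : ℕ → Bool) : ℕ → ℕ → List Bool
  | _, 0 => []
  | s, l + 1 => b s :: word b (s + 1) l

/-- The mean of `F` over the `2 ^ n` words of length `n`. -/
noncomputable def avg : ℕ → (List Bool → ℝ) → ℝ
  | 0, F => F []
  | n + 1, F => (avg n (fun w => F (true :: w)) + avg n (fun w => F (false :: w))) / 2

/-- The sum of `2 ^ (-|w|) * F w` over all words `w` of length at most `N`. -/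
noncomputable def green (N : ℕ) (F : List Bool → ℝ) : ℝ := ∑ j ∈ Finset.range (N + 1), avg j F

/-- The sum of `G u * H v` over all ways to write a word as a concatenation `u ++ v`. -/
noncomputable def conv : (List Bool → ℝ) → (List Bool → ℝ) → List Bool → ℝ
  | G, H, [] => G [] * H []
  | G, H, b :: w => G [] * H (b :: w) + conv (fun u => G (b :: u)) H w

theorem height_succ (b : ℕ → Bool) (n : ℕ) : height b (n + 1) = height b n + step (b n) :=
  Finset.sum_range_succ _ _

theorem height_succ_le (b : ℕ → Bool) (n : ℕ) : height b (n + 1) ≤ height b n + 1 := by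
  rw [height_succ]; unfold step; split <;> omega

theorem word_add (b : ℕ → Bool) (s l r : ℕ) :
    word b s (l + r) = word b s l ++ word b (s + l) r := by
  induction l generalizing s with
  | zero => simp [word]
  | succ l ih =>
    rw [show l + 1 + r = (l + r) + 1 by omega]
    simp only [word, ih, List.cons_append]
    rw [show s + 1 + l = s + (l + 1) by omega]

theorem avg_nonneg {F : List Bool → ℝ} (hF : ∀ w, 0 ≤ F w) (n : ℕ) : 0 ≤ avg n F := by
  induction n generalizing F with
  | zero => exact hF _
  | succ n ih =>
    have h1 := ih (F := fun w => F (true :: w)) fun w => hF _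
    have h2 := ih (F := fun w => F (false :: w)) fun w => hF _
    simp only [avg]; linarith

theorem avg_add (F G : List Bool → ℝ) (n : ℕ) :
    avg n (fun w => F w + G w) = avg n F + avg n G := by
  induction n generalizing F G with
  | zero => rfl
  | succ n ih => simp only [avg]; rw [ih, ih]; ring

theorem avg_const_mul (c : ℝ) (F : List Bool → ℝ) (n : ℕ) :
    avg n (fun w => c * F w) = c * avg n F := by
  induction n generalizing F with
  | zero => rfl
  | succ n ih => simp only [avg]; rw [ih, ih]; ring

theorem green_nonneg {F : List Bool → ℝ} (hF : ∀ w, 0 ≤ F w) (N : ℕ) : 0 ≤ green N F :=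
  Finset.sum_nonneg fun j _ => avg_nonneg hF j

theorem green_zero (F : List Bool → ℝ) : green 0 F = F [] := by simp [green, avg]

theorem green_succ (N : ℕ) (F : List Bool → ℝ) :
    green (N + 1) F =
      F [] + (green N (fun w => F (true :: w)) + green N (fun w => F (false :: w))) / 2 := by
  unfold green
  rw [Finset.sum_range_succ']
  simp only [avg]
  rw [← Finset.sum_div, Finset.sum_add_distrib]
  ring

theorem green_le_succ {F : List Bool → ℝ} (hF : ∀ w, 0 ≤ F w) (N : ℕ) :
    green N F ≤ green (N + 1) F := by
  unfold green
  rw [Finset.sum_range_succ _ (N + 1)]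
  linarith [avg_nonneg hF (N + 1)]

theorem green_add (F G : List Bool → ℝ) (N : ℕ) :
    green N (fun w => F w + G w) = green N F + green N G := by
  simp only [green, avg_add, Finset.sum_add_distrib]

theorem green_const_mul (c : ℝ) (F : List Bool → ℝ) (N : ℕ) :
    green N (fun w => c * F w) = c * green N F := by
  simp only [green, avg_const_mul, Finset.mul_sum]

theorem green_zero_fun (N : ℕ) : green N (fun _ => 0) = 0 := by
  simpa using green_const_mul 0 (fun _ => 0) N

theorem conv_nonneg {G H : List Bool → ℝ} (hG : ∀ w, 0 ≤ G w) (hH : ∀ w, 0 ≤ H w)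
    (w : List Bool) : 0 ≤ conv G H w := by
  induction w generalizing G with
  | nil => exact mul_nonneg (hG _) (hH _)
  | cons b w ih => exact add_nonneg (mul_nonneg (hG _) (hH _)) (ih fun u => hG _)

theorem mul_le_conv {G H : List Bool → ℝ} (hG : ∀ w, 0 ≤ G w) (hH : ∀ w, 0 ≤ H w)
    (u v : List Bool) : G u * H v ≤ conv G H (u ++ v) := by
  induction u generalizing G with
  | nil =>
    cases v with
    | nil => exact le_rfl
    | cons b w =>
      simp only [List.nil_append, conv]
      linarith [conv_nonneg (G := fun u => G (b :: u)) (fun u => hG _) hH w]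
  | cons b u ih =>
    simp only [List.cons_append, conv]
    have h1 := ih (G := fun u => G (b :: u)) fun u => hG _
    have h2 := mul_nonneg (hG []) (hH (b :: (u ++ v)))
    linarith

/-- The total weight of a concatenation is at most the product of the total weights. -/
theorem green_conv_le {G H : List Bool → ℝ} (hG : ∀ w, 0 ≤ G w) (hH : ∀ w, 0 ≤ H w) (N : ℕ) :
    green N (conv G H) ≤ green N G * green N H := by
  induction N generalizing G with
  | zero => simp [green_zero, conv]
  | succ N ih =>
    have hle := green_le_succ hH N
    have key : ∀ b : Bool, green N (fun w => conv G H (b :: w)) ≤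
        G [] * green N (fun w => H (b :: w)) + green N (fun w => G (b :: w)) * green (N + 1) H := by
      intro b
      simp only [conv]
      rw [green_add, green_const_mul]
      have h1 := ih (G := fun u => G (b :: u)) fun u => hG _
      have h2 := mul_le_mul_of_nonneg_left hle
        (green_nonneg (F := fun w => G (b :: w)) (fun w => hG _) N)
      linarith
    have ht := key true
    have hf := key false
    rw [green_succ N (conv G H), green_succ N G]
    have e := green_succ N H
    simp only [conv] at ht hf ⊢
    have : G [] * green (N + 1) H = G [] * H [] + (G [] * green N (fun w => H (true :: w))
      + G [] * green N (fun w => H (false :: w))) / 2 := by rw [e]; ring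
    linarith

/-! ### The walk reflected at its minimum -/

/-- The indicator, as a function of the word of tosses, that the walk started at `y` and reflected
at `0` stays below `m`. -/
noncomputable def stayWeight (m : ℤ) : ℤ → List Bool → ℝ
  | y, [] => if y < m then 1 else 0
  | y, b :: w => if y < m then stayWeight m (max (y + step b) 0) w else 0

theorem stayWeight_mem (m y : ℤ) (w : List Bool) :
    0 ≤ stayWeight m y w ∧ stayWeight m y w ≤ 1 := by
  induction w generalizing y with
  | nil => simp only [stayWeight]; split <;> norm_num
  | cons b w ih =>
    simp only [stayWeight]
    split
    · exact ih _
    · norm_num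

/-- The function `m ^ 2 + m - y ^ 2 - y` vanishes at `y = m` and its mean over one step of the
reflected walk is smaller by `1`; so it bounds the expected time spent below `m`. -/
theorem green_stayWeight_le (m : ℤ) (N : ℕ) (y : ℤ) (h0 : 0 ≤ y) (hm : y ≤ m) :
    green N (stayWeight m y) ≤ (m : ℝ) ^ 2 + m - y ^ 2 - y := by
  rcases hm.eq_or_lt with rfl | hlt
  · have : stayWeight y y = fun _ => 0 := by
      funext w; cases w <;> simp [stayWeight]
    rw [this, green_zero_fun]; simp
  have h0' : (0 : ℝ) ≤ y := by exact_mod_cast h0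
  have hlt' : (y : ℝ) + 1 ≤ m := by exact_mod_cast hlt
  induction N generalizing y with
  | zero =>
    simp only [green_zero, stayWeight, hlt, if_true]
    nlinarith
  | succ N ih =>
    have step1 : ∀ z : ℤ, 0 ≤ z → z ≤ m →
        green N (stayWeight m z) ≤ (m : ℝ) ^ 2 + m - z ^ 2 - z := by
      intro z hz hzm
      rcases hzm.eq_or_lt with rfl | hz'
      · have : stayWeight z z = fun _ => 0 := by
          funext w; cases w <;> simp [stayWeight]
        rw [this, green_zero_fun]; simp
      · exact ih z hz hzm hz' (by exact_mod_cast hz) (by exact_mod_cast hz')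
    rw [green_succ]
    simp only [stayWeight, hlt, if_true, step]
    have h1 := step1 (y + 1) (by omega) (by omega)
    rw [show max (y + 1) 0 = y + 1 by omega]
    simp only [Bool.false_eq_true, if_false]
    rcases h0.eq_or_lt with rfl | hpos
    · have h2 := step1 0 le_rfl (by omega)
      rw [show max ((0 : ℤ) + -1) 0 = 0 by omega]
      push_cast at h1 h2 ⊢
      linarith
    · have h2 := step1 (y - 1) (by omega) (by omega)
      rw [show max (y + -1) 0 = y - 1 by omega]
      push_cast at h1 h2 ⊢
      linarith

theorem avg_stayWeight_succ_le (m : ℤ) (n : ℕ) (y : ℤ) :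
    avg (n + 1) (stayWeight m y) ≤ avg n (stayWeight m y) := by
  by_cases hy : y < m
  · induction n generalizing y with
    | zero =>
      have h1 := (stayWeight_mem m (max (y + step true) 0) []).2
      have h2 := (stayWeight_mem m (max (y + step false) 0) []).2
      simp only [avg]
      simp only [stayWeight, hy, if_true] at h1 h2 ⊢
      linarith
    | succ n ih =>
      have step1 : ∀ z, avg (n + 1) (stayWeight m z) ≤ avg n (stayWeight m z) := by
        intro z
        by_cases hz : z < m
        · exact ih z hz
        · have : stayWeight m z = fun w => 0 * stayWeight m z w := by
            funext w; cases w <;> simp [stayWeight, hz]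
          rw [this, avg_const_mul, avg_const_mul]; simp
      have h1 := step1 (max (y + step true) 0)
      have h2 := step1 (max (y + step false) 0)
      have e : ∀ n, avg (n + 1) (stayWeight m y) = (avg n (stayWeight m (max (y + step true) 0)) +
          avg n (stayWeight m (max (y + step false) 0))) / 2 := by
        intro n
        rw [avg]
        simp only [stayWeight, hy, if_true]
      rw [e, e]
      linarith
  · have : stayWeight m y = fun w => 0 * stayWeight m y w := by
      funext w; cases w <;> simp [stayWeight, hy]
    rw [this, avg_const_mul, avg_const_mul]; simp

theorem avg_stayWeight_le (m : ℤ) (hm : 0 ≤ m) (N : ℕ) :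
    avg N (stayWeight m 0) ≤ ((m : ℝ) ^ 2 + m) / (N + 1) := by
  have hanti : Antitone fun n => avg n (stayWeight m 0) :=
    antitone_nat_of_succ_le fun n => avg_stayWeight_succ_le m n 0
  have h1 := green_stayWeight_le m N 0 le_rfl hm
  have h2 : ((N : ℝ) + 1) * avg N (stayWeight m 0) ≤ green N (stayWeight m 0) := by
    have := Finset.card_nsmul_le_sum (Finset.range (N + 1)) (fun j => avg j (stayWeight m 0))
      (avg N (stayWeight m 0)) fun j hj => hanti (by simpa [Nat.lt_succ_iff] using hj)
    simpa [green] using this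
  rw [le_div_iff₀ (by positivity)]
  push_cast at h1
  linarith

/-- If no increment of the walk over a time interval reaches `m`, the reflected walk stays
below `m`. -/
theorem stayWeight_word_eq_one (b : ℕ → Bool) (m : ℤ) (l s : ℕ) (y : ℤ)
    (hy : ∀ j ≤ l, y + (height b (s + j) - height b s) < m)
    (hd : ∀ i j, i ≤ j → j ≤ l → height b (s + j) - height b (s + i) < m) :
    stayWeight m y (word b s l) = 1 := by
  induction l generalizing s y with
  | zero =>
    have := hy 0 le_rfl
    simp only [add_zero, sub_self] at this
    simp [word, stayWeight, this]
  | succ l ih =>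
    have h0 := hy 0 (by omega)
    simp only [add_zero, sub_self] at h0
    simp only [word, stayWeight, h0, if_true]
    apply ih
    · intro j hj
      have h1 := hy (j + 1) (by omega)
      have h2 := hd 1 (j + 1) (by omega) (by omega)
      have h3 := height_succ b s
      rw [show s + 1 + j = s + (j + 1) by omega]
      rcases max_cases (y + step (b s)) 0 with ⟨h, _⟩ | ⟨h, _⟩ <;> rw [h] <;> omega
    · intro i j hij hj
      have := hd (i + 1) (j + 1) (by omega) (by omega)
      rw [show s + 1 + j = s + (j + 1) by omega, show s + 1 + i = s + (i + 1) by omega]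
      exact this

/-! ### Weights of loops and crossings -/

/-- The weight, as a function of the word of tosses, of a walk which starts at `x`, stays strictly
between `-M` and `M` and ends at `0`: a factor `β` for every visit to `0`, the final one
excluded. All other walks have weight `0`. -/
noncomputable def loopWeight (β : ℝ) (M : ℤ) : ℤ → List Bool → ℝ
  | x, [] => if x = 0 then 1 else 0
  | x, b :: w => if |x| < M then (if x = 0 then β else 1) * loopWeight β M (x + step b) w else 0

/-- The weight of a crossing of height `2 ^ k`, defined by cutting a crossing of height
`2 ^ (k + 1)` at its first and last visit to the middle level: the two outer parts are crossings of
height `2 ^ k`, and the inner part is a loop. -/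
noncomputable def crossWeight (β : ℝ) : ℕ → List Bool → ℝ
  | 0 => fun w => if w = [true] then 1 else 0
  | k + 1 => conv (crossWeight β k) (conv (loopWeight β (2 ^ k) 0) (crossWeight β k))

theorem loopWeight_nonneg {β : ℝ} (hβ : 0 ≤ β) (M x : ℤ) (w : List Bool) :
    0 ≤ loopWeight β M x w := by
  induction w generalizing x with
  | nil => simp only [loopWeight]; split <;> norm_num
  | cons b w ih =>
    simp only [loopWeight]
    split
    · refine mul_nonneg ?_ (ih _)
      split <;> linarith
    · norm_num

theorem crossWeight_nonneg {β : ℝ} (hβ : 0 ≤ β) (k : ℕ) (w : List Bool) :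
    0 ≤ crossWeight β k w := by
  induction k generalizing w with
  | zero => simp only [crossWeight]; split <;> norm_num
  | succ k ih =>
    exact conv_nonneg ih (conv_nonneg (loopWeight_nonneg hβ _ _) ih) w

/-- The tent function of height `D`, for the `D` with `D = 1 + β * D * (1 - 1 / M)`, satisfies the
one-step equations of the total loop weight. -/
theorem green_loopWeight_le {β : ℝ} (h0 : 0 ≤ β) {M : ℤ} (hM : 0 < M) {D : ℝ}
    (hD : D = 1 + β * (D * (1 - 1 / M))) (hD1 : 1 ≤ D) (N : ℕ) (x : ℤ) (hx : |x| ≤ M) :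
    green N (loopWeight β M x) ≤ D * (1 - |(x : ℝ)| / M) := by
  have hM' : (0 : ℝ) < M := by exact_mod_cast hM
  induction N generalizing x with
  | zero =>
    simp only [green_zero, loopWeight]
    split_ifs with h
    · subst h; simpa using hD1
    · refine mul_nonneg (by linarith) (sub_nonneg.2 ((div_le_one hM').2 ?_))
      exact_mod_cast hx
  | succ N ih =>
    rw [green_succ]
    rcases hx.eq_or_lt with hx' | hlt
    · have hx0 : x ≠ 0 := by rintro rfl; simp at hx'; omega
      have e : |(x : ℝ)| = M := by exact_mod_cast hx'
      simp only [loopWeight, hx', lt_irrefl, if_false, hx0, green_zero_fun, e]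
      rw [div_self hM'.ne']; simp
    · simp only [loopWeight, hlt, if_true, green_const_mul, step, Bool.false_eq_true, if_false]
      rw [abs_lt] at hlt
      have hp := ih (x + 1) (by rw [abs_le]; omega)
      have hn := ih (x + -1) (by rw [abs_le]; omega)
      push_cast at hp hn
      rcases lt_trichotomy x 0 with hneg | rfl | hpos
      · have a : (x : ℝ) + 1 ≤ 0 := by exact_mod_cast hneg
        rw [abs_of_nonpos a] at hp
        rw [abs_of_nonpos (by linarith)] at hn
        rw [abs_of_nonpos (by linarith), if_neg hneg.ne, if_neg hneg.ne]
        calc _ ≤ (D * (1 - -((x : ℝ) + 1) / M) + D * (1 - -((x : ℝ) + -1) / M)) / 2 := by linarith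
          _ = _ := by ring
      · norm_num at hp hn
        norm_num
        have : β * green N (loopWeight β M 1) ≤ β * (D * (1 - 1 / M)) :=
          mul_le_mul_of_nonneg_left (by simpa using hp) h0
        have : β * green N (loopWeight β M (-1)) ≤ β * (D * (1 - 1 / M)) :=
          mul_le_mul_of_nonneg_left (by simpa using hn) h0
        linarith
      · have a : (1 : ℝ) ≤ x := by exact_mod_cast hpos
        rw [abs_of_nonneg (by linarith)] at hp
        rw [abs_of_nonneg (by linarith)] at hn
        rw [abs_of_nonneg (by linarith), if_neg hpos.ne', if_neg hpos.ne']
        calc _ ≤ (D * (1 - ((x : ℝ) + 1) / M) + D * (1 - ((x : ℝ) + -1) / M)) / 2 := by linarith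
          _ = _ := by ring

theorem green_loopWeight_zero_le {β : ℝ} (h0 : 0 ≤ β) (h1 : β ≤ 1) (k N : ℕ) :
    green N (loopWeight β (2 ^ k) 0) ≤ 2 ^ k / (1 + (1 - β) * (2 ^ k - 1)) := by
  have hM : (1 : ℝ) ≤ 2 ^ k := one_le_pow₀ (by norm_num)
  have hpos : 0 < 1 + (1 - β) * ((2 : ℝ) ^ k - 1) := by
    have := mul_nonneg (sub_nonneg.2 h1) (sub_nonneg.2 hM)
    linarith
  have := green_loopWeight_le h0 (M := 2 ^ k) (by positivity)
    (D := 2 ^ k / (1 + (1 - β) * (2 ^ k - 1)))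
    (by push_cast; field_simp; ring)
    (by rw [le_div_iff₀ hpos]; nlinarith [mul_nonneg h0 (sub_nonneg.2 hM)]) N 0 (by simp)
  simpa using this

theorem green_crossWeight_zero (β : ℝ) (N : ℕ) : green N (crossWeight β 0) ≤ 1 / 2 := by
  have hnil : ∀ n, green n (fun w : List Bool => if w = [] then (1 : ℝ) else 0) = 1 := by
    intro n
    cases n with
    | zero => simp [green_zero]
    | succ n => rw [green_succ]; simp [green_zero_fun]
  cases N with
  | zero => simp [green_zero, crossWeight]
  | succ n =>
    rw [green_succ]
    simp [crossWeight, green_zero_fun, hnil]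

/-- The normalization `2 ^ (k + 1)` is the inverse of the probability that the walk makes a crossing
of height `2 ^ k` before it returns to its starting level, so `g = 1` corresponds to `β = 1`. -/
theorem green_crossWeight_succ_le {β : ℝ} (h0 : 0 ≤ β) (h1 : β ≤ 1) (k N : ℕ) {g : ℝ}
    (hg : green N (crossWeight β k) ≤ g / 2 ^ (k + 1)) :
    green N (crossWeight β (k + 1)) ≤
      g ^ 2 / (1 + (1 - β) * (2 ^ k - 1)) / 2 ^ (k + 2) := by
  have hc := crossWeight_nonneg h0 k
  have hl := loopWeight_nonneg h0 (2 ^ k) 0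
  have hG := green_nonneg hc N
  have hL := green_loopWeight_zero_le h0 h1 k N
  have hL0 := green_nonneg hl N
  calc green N (crossWeight β (k + 1))
      ≤ green N (crossWeight β k) *
          (green N (loopWeight β (2 ^ k) 0) * green N (crossWeight β k)) :=
        (green_conv_le hc (conv_nonneg hl hc) N).trans
          (mul_le_mul_of_nonneg_left (green_conv_le hl hc N) hG)
    _ ≤ g / 2 ^ (k + 1) * (2 ^ k / (1 + (1 - β) * (2 ^ k - 1)) * (g / 2 ^ (k + 1))) := by
        have : 0 ≤ g / 2 ^ (k + 1) := hG.trans hg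
        gcongr
        exact hL0.trans hL
    _ = _ := by
        rw [div_div, div_mul_div_comm, div_mul_div_comm, pow_add 2 k 1, pow_add 2 k 2]
        have : (2 : ℝ) ^ k ≠ 0 := by positivity
        by_cases hz : 1 + (1 - β) * ((2 : ℝ) ^ k - 1) = 0
        · simp [hz]
        · field_simp

/-- As long as the height stays below `1 / r`, every level contributes in expectation a constant
proportion of the height. -/
theorem green_crossWeight_le_exp {r : ℝ} (hr : 0 ≤ r) (k N : ℕ) (hk : r * 2 ^ k ≤ 1) :
    green N (crossWeight (Real.exp (-r)) k) ≤
      Real.exp (-(r * (2 ^ k * (k / 8 - 1 / 4) + 1 / 4))) / 2 ^ (k + 1) := by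
  have hβ1 : Real.exp (-r) ≤ 1 := Real.exp_le_one_iff.2 (by linarith)
  induction k with
  | zero =>
    refine (green_crossWeight_zero _ N).trans (le_of_eq ?_)
    norm_num
  | succ k ih =>
    have hM : (1 : ℝ) ≤ 2 ^ k := one_le_pow₀ (by norm_num)
    rw [pow_succ] at hk
    have hk' : r * 2 ^ k ≤ 1 := by nlinarith
    have hr1 : r ≤ 1 := by nlinarith
    refine (green_crossWeight_succ_le (Real.exp_pos _).le hβ1 k N (ih hk')).trans ?_
    refine div_le_div_of_nonneg_right ?_ (by positivity)
    have hρ : r / 2 ≤ 1 - Real.exp (-r) := by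
      have h2 : Real.exp (-r) ≤ 1 / (1 + r) := by
        rw [Real.exp_neg, ← one_div]
        exact one_div_le_one_div_of_le (by linarith) (by linarith [Real.add_one_le_exp r])
      have h3 : 1 / (1 + r) ≤ 1 - r / 2 := by
        rw [div_le_iff₀ (by linarith)]; nlinarith
      linarith
    set x := r / 4 * (2 ^ k - 1) with hx
    have hx0 : 0 ≤ x := mul_nonneg (by linarith) (by linarith)
    have hx1 : x ≤ 1 / 2 := by nlinarith
    have hexp : Real.exp x ≤ 1 + (1 - Real.exp (-r)) * (2 ^ k - 1) := by
      have h4 : Real.exp x ≤ 1 / (1 - x) := by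
        have := Real.add_one_le_exp (-x)
        rw [le_div_iff₀ (by linarith)]
        calc Real.exp x * (1 - x) ≤ Real.exp x * Real.exp (-x) := by gcongr; linarith
          _ = 1 := by rw [← Real.exp_add]; simp
      have h5 : 1 / (1 - x) ≤ 1 + 2 * x := by
        rw [div_le_iff₀ (by linarith)]; nlinarith
      have h6 : 2 * x ≤ (1 - Real.exp (-r)) * (2 ^ k - 1) := by
        rw [hx]
        nlinarith
      linarith
    calc _ ≤ Real.exp (-(r * (2 ^ k * (k / 8 - 1 / 4) + 1 / 4))) ^ 2 / Real.exp x := by gcongr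
      _ = _ := by
        rw [← Real.exp_nat_mul, ← Real.exp_sub, hx]
        congr 1
        push_cast
        ring

/-- Squaring at each doubling of the height turns `exp (-c)` into `exp (-(2 ^ j * c))`; the gain from
the loops is discarded. -/
theorem green_crossWeight_add_le {β : ℝ} (h0 : 0 ≤ β) (h1 : β ≤ 1) (k N : ℕ) {c : ℝ}
    (hg : green N (crossWeight β k) ≤ Real.exp (-c) / 2 ^ (k + 1)) (j : ℕ) :
    green N (crossWeight β (k + j)) ≤ Real.exp (-(2 ^ j * c)) / 2 ^ (k + j + 1) := by
  induction j with
  | zero => simpa using hg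
  | succ j ih =>
    refine (green_crossWeight_succ_le h0 h1 (k + j) N ih).trans ?_
    refine div_le_div_of_nonneg_right ?_ (by positivity)
    have hM : (1 : ℝ) ≤ 2 ^ (k + j) := one_le_pow₀ (by norm_num)
    refine (div_le_self (by positivity) ?_).trans (le_of_eq ?_)
    · have := mul_nonneg (sub_nonneg.2 h1) (sub_nonneg.2 hM)
      linarith
    · rw [← Real.exp_nat_mul]
      congr 1
      push_cast
      ring

/-! ### Increasing subsequences of crossings -/

theorem exists_loopWeight_word (b : ℕ → Bool) (β : ℝ) (M c : ℤ) (l s : ℕ)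
    (hM : ∀ i < l, |height b (s + i) - c| < M) (hend : height b (s + l) = c) :
    ∃ A ⊆ Finset.Ico s (s + l), (∀ i ∈ A, height b i = c) ∧
      loopWeight β M (height b s - c) (word b s l) = β ^ A.card := by
  induction l generalizing s with
  | zero =>
    refine ⟨∅, by simp, by simp, ?_⟩
    simp only [add_zero] at hend
    simp [word, loopWeight, hend]
  | succ l ih =>
    obtain ⟨A, hA, hAc, hw⟩ := ih (s + 1)
      (fun i hi => by rw [show s + 1 + i = s + (i + 1) by omega]; exact hM _ (by omega))
      (by rw [← hend]; congr 1; omega)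
    have h0 := hM 0 (by omega)
    rw [add_zero] at h0
    have hstep : height b s - c + step (b s) = height b (s + 1) - c := by
      rw [height_succ]; ring
    simp only [word, loopWeight, h0, if_true, hstep, hw]
    have hs : s ∉ A := fun h => by have := hA h; simp at this
    by_cases hz : height b s = c
    · refine ⟨insert s A, ?_, ?_, ?_⟩
      · intro i hi
        rw [Finset.mem_insert] at hi
        rcases hi with rfl | hi
        · simp
        · have := hA hi
          simp only [Finset.mem_Ico] at this ⊢
          omega
      · simpa [hz] using hAc
      · rw [Finset.card_insert_of_notMem hs, if_pos (by omega)]; ring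
    · refine ⟨A, fun i hi => ?_, hAc, ?_⟩
      · have := hA hi
        simp only [Finset.mem_Ico] at this ⊢
        omega
      · rw [if_neg (by omega), one_mul]

/-- A union of two sets of times on which `f` is monotone is again such a set if all the times, and
all the values, of the first lie below those of the second. -/
theorem monotoneOn_union {f : ℕ → ℤ} {A B : Finset ℕ} {t : ℕ} {c : ℤ}
    (hA : MonotoneOn f (A : Set ℕ)) (hB : MonotoneOn f (B : Set ℕ))
    (hAt : ∀ i ∈ A, i < t) (hBt : ∀ i ∈ B, t ≤ i)
    (hAc : ∀ i ∈ A, f i ≤ c) (hBc : ∀ i ∈ B, c ≤ f i) :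
    MonotoneOn f ((A ∪ B : Finset ℕ) : Set ℕ) := by
  intro i hi j hj hij
  simp only [Finset.coe_union, Set.mem_union, Finset.mem_coe] at hi hj
  rcases hi with hi | hi <;> rcases hj with hj | hj
  · exact hA hi hj hij
  · exact (hAc i hi).trans (hBc j hj)
  · have := hAt j hj
    have := hBt i hi
    omega
  · exact hB hi hj hij

/-- The walk makes a crossing of height `m` during `[s, s + l]`: it ends `m` above its starting
level, and lies strictly in between at the intermediate times. -/
def IsCrossing (b : ℕ → Bool) (m : ℤ) (s l : ℕ) : Prop :=
  height b (s + l) = height b s + m ∧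
    ∀ i, 0 < i → i < l → height b s < height b (s + i) ∧ height b (s + i) < height b s + m

/-- A crossing of height `2 * M` is a crossing of height `M`, followed by an excursion around the
middle level, followed by another crossing of height `M`. -/
theorem IsCrossing.split {b : ℕ → Bool} {M : ℤ} {s l : ℕ} (hM : 0 < M)
    (h : IsCrossing b (2 * M) s l) :
    ∃ p q r, l = p + (q + r) ∧ IsCrossing b M s p ∧
      (∀ i < q, |height b (s + p + i) - (height b s + M)| < M) ∧
      height b (s + p + q) = height b s + M ∧ IsCrossing b M (s + p + q) r := by
  classical
  obtain ⟨hend, hmid⟩ := h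
  have hex : ∃ i, height b s + M ≤ height b (s + i) := ⟨l, by omega⟩
  -- `p` is the first time at the middle level, `t` the last one
  obtain ⟨p, hp, hpmin⟩ : ∃ p, height b s + M ≤ height b (s + p) ∧
      ∀ i < p, height b (s + i) < height b s + M :=
    ⟨Nat.find hex, Nat.find_spec hex, fun i hi => not_le.1 (Nat.find_min hex hi)⟩
  have hpl : p ≤ l := by
    by_contra hlt
    have := hpmin l (by omega)
    omega
  have hp0 : 0 < p := by
    rcases Nat.eq_zero_or_pos p with rfl | h
    · simp at hp; omega
    · exact h
  have hpe : height b (s + p) = height b s + M := by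
    have h1 := hpmin (p - 1) (by omega)
    have h2 := height_succ_le b (s + (p - 1))
    rw [show s + (p - 1) + 1 = s + p by omega] at h2
    omega
  have hpl' : p < l := by
    rcases hpl.eq_or_lt with rfl | h
    · omega
    · exact h
  obtain ⟨t, hpt, htl, ht, htmax⟩ : ∃ t, p ≤ t ∧ t ≤ l ∧ height b (s + t) ≤ height b s + M ∧
      ∀ i, t < i → i ≤ l → height b s + M < height b (s + i) := by
    refine ⟨Nat.findGreatest (fun i => height b (s + i) ≤ height b s + M) l,
      Nat.le_findGreatest hpl hpe.le, Nat.findGreatest_le l,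
      Nat.findGreatest_spec (P := fun i => height b (s + i) ≤ height b s + M) hpl hpe.le, ?_⟩
    intro i hi hil
    exact not_le.1 (Nat.findGreatest_is_greatest hi hil)
  have htl' : t < l := by
    rcases htl.eq_or_lt with rfl | h
    · omega
    · exact h
  have hte : height b (s + t) = height b s + M := by
    have h1 := htmax (t + 1) (by omega) (by omega)
    have h2 := height_succ_le b (s + t)
    rw [show s + t + 1 = s + (t + 1) by omega] at h2
    omega
  refine ⟨p, t - p, l - t, by omega, ⟨hpe, fun i hi hip => ⟨(hmid i hi (by omega)).1, hpmin i hip⟩⟩,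
    ?_, ?_, ?_⟩
  · intro i hi
    have := hmid (p + i) (by omega) (by omega)
    rw [show s + p + i = s + (p + i) by omega, abs_lt]
    omega
  · rw [show s + p + (t - p) = s + t by omega, hte]
  · rw [show s + p + (t - p) = s + t by omega]
    refine ⟨?_, ?_⟩
    · rw [show s + t + (l - t) = s + l by omega]; omega
    · intro i hi hil
      have h1 := hmid (t + i) (by omega) (by omega)
      have h2 := htmax (t + i) (by omega) (by omega)
      rw [show s + t + i = s + (t + i) by omega]
      omega

/-- A crossing of height `2 ^ k` carries an increasing subsequence whose length is measured by
`crossWeight`: the visits to the middle level are inserted between the subsequences of the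
two halves. -/
theorem exists_monotoneOn_of_isCrossing (b : ℕ → Bool) {β : ℝ} (hβ : 0 ≤ β) (k s l : ℕ)
    (h : IsCrossing b (2 ^ k) s l) :
    ∃ A ⊆ Finset.Ico s (s + l), MonotoneOn (height b) (A : Set ℕ) ∧
      (∀ i ∈ A, height b s ≤ height b i ∧ height b i ≤ height b s + 2 ^ k) ∧
      β ^ A.card ≤ crossWeight β k (word b s l) := by
  induction k generalizing s l with
  | zero =>
    obtain ⟨hend, hmid⟩ := h
    have hl : l = 1 := by
      rcases l with _ | _ | l
      · simp at hend
      · rfl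
      · have := hmid 1 (by omega) (by omega)
        omega
    subst hl
    have hb : b s = true := by
      rw [height_succ] at hend
      by_contra hb
      simp [step, hb] at hend
    exact ⟨∅, by simp, by simp [MonotoneOn], by simp, by simp [crossWeight, word, hb]⟩
  | succ k ih =>
    have hM : (0 : ℤ) < 2 ^ k := by positivity
    rw [pow_succ'] at h
    obtain ⟨p, q, r, rfl, h1, h2, h3, h4⟩ := h.split hM
    obtain ⟨A, hA, hAm, hAv, hAw⟩ := ih _ _ h1
    obtain ⟨C, hC, hCm, hCv, hCw⟩ := ih _ _ h4
    obtain ⟨B, hB, hBv, hBw⟩ := exists_loopWeight_word b β (2 ^ k) (height b s + 2 ^ k) q (s + p)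
      h2 h3
    rw [h1.1, sub_self] at hBw
    have hA' : ∀ i ∈ A, s ≤ i ∧ i < s + p := fun i hi => Finset.mem_Ico.1 (hA hi)
    have hB' : ∀ i ∈ B, s + p ≤ i ∧ i < s + p + q := fun i hi => Finset.mem_Ico.1 (hB hi)
    have hC' : ∀ i ∈ C, s + p + q ≤ i ∧ i < s + p + q + r := fun i hi => Finset.mem_Ico.1 (hC hi)
    rw [h3] at hCv
    have hBm : MonotoneOn (height b) (B : Set ℕ) := fun i hi j hj _ => by
      rw [hBv i hi, hBv j hj]
    have hABm := monotoneOn_union (c := height b s + 2 ^ k) hAm hBm (fun i hi => (hA' i hi).2)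
      (fun i hi => (hB' i hi).1) (fun i hi => (hAv i hi).2) (fun i hi => (hBv i hi).ge)
    have hABCm := monotoneOn_union (t := s + p + q) (c := height b s + 2 ^ k) hABm hCm
      (fun i hi => by
        rcases Finset.mem_union.1 hi with hi | hi
        · have := hA' i hi; omega
        · exact (hB' i hi).2)
      (fun i hi => (hC' i hi).1)
      (fun i hi => by
        rcases Finset.mem_union.1 hi with hi | hi
        · exact (hAv i hi).2
        · exact (hBv i hi).le)
      (fun i hi => (hCv i hi).1)
    refine ⟨A ∪ B ∪ C, ?_, hABCm, ?_, ?_⟩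
    · intro i hi
      simp only [Finset.mem_union] at hi
      rw [Finset.mem_Ico]
      rcases hi with (hi | hi) | hi
      · have := hA' i hi; omega
      · have := hB' i hi; omega
      · have := hC' i hi; omega
    · intro i hi
      simp only [Finset.mem_union] at hi
      rw [pow_succ']
      rcases hi with (hi | hi) | hi
      · have := hAv i hi; omega
      · have := hBv i hi; omega
      · have := hCv i hi; omega
    · have hdAB : Disjoint A B := Finset.disjoint_left.2 fun i hi hi' => by
        have := hA' i hi
        have := hB' i hi'
        omega
      have hdABC : Disjoint (A ∪ B) C := Finset.disjoint_left.2 fun i hi hi' => by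
        have := hC' i hi'
        rcases Finset.mem_union.1 hi with hi | hi
        · have := hA' i hi; omega
        · have := hB' i hi; omega
      rw [Finset.card_union_of_disjoint hdABC, Finset.card_union_of_disjoint hdAB, pow_add, pow_add,
        word_add, word_add, mul_assoc]
      have hcn := crossWeight_nonneg hβ k
      have hln := loopWeight_nonneg hβ (2 ^ k) 0
      refine le_trans ?_ (mul_le_conv hcn (conv_nonneg hln hcn) _ _)
      refine mul_le_mul hAw ?_ (by positivity) (hcn _)
      refine le_trans ?_ (mul_le_conv hln hcn _ _)
      rw [hBw]
      exact mul_le_mul_of_nonneg_left hCw (by positivity)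

/-- A shortest time interval over which the walk gains at least `m` is a crossing. -/
theorem exists_isCrossing (b : ℕ → Bool) {m : ℤ} (hm : 0 < m) {N i j : ℕ} (hij : i ≤ j)
    (hj : j ≤ N) (h : m ≤ height b j - height b i) :
    ∃ s l, s + l ≤ N ∧ IsCrossing b m s l := by
  classical
  have hex : ∃ l s, s + l ≤ N ∧ m ≤ height b (s + l) - height b s :=
    ⟨j - i, i, by omega, by rwa [show i + (j - i) = j by omega]⟩
  obtain ⟨s, hs, hgain⟩ := Nat.find_spec hex
  have hmin : ∀ l' < Nat.find hex, ∀ s', s' + l' ≤ N → height b (s' + l') - height b s' < m := by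
    intro l' hl' s' hs'
    by_contra hcon
    exact Nat.find_min hex hl' ⟨s', hs', not_lt.1 hcon⟩
  generalize Nat.find hex = l at hs hgain hmin
  have hl0 : 0 < l := by
    rcases Nat.eq_zero_or_pos l with rfl | h
    · simp at hgain; omega
    · exact h
  refine ⟨s, l, hs, ?_, fun i hi hil => ⟨?_, ?_⟩⟩
  · have h1 := hmin (l - 1) (by omega) s (by omega)
    have h2 := height_succ_le b (s + (l - 1))
    rw [show s + (l - 1) + 1 = s + l by omega] at h2
    omega
  · have h1 := hmin (l - i) (by omega) (s + i) (by omega)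
    rw [show s + i + (l - i) = s + l by omega] at h1
    omega
  · have h1 := hmin i hil s (by omega)
    omega

/-! ### Independent fair coins -/

section Coins

variable {Ω : Type*} [MeasurableSpace Ω] {μ : Measure Ω} {b : ℕ → Ω → Bool}

/-- The tosses `b 0, b 1, …` are independent and fair. -/
structure IsFairCoin (b : ℕ → Ω → Bool) (μ : Measure Ω) : Prop where
  measurable : ∀ i, Measurable (b i)
  indep : iIndepFun b μ
  fair : ∀ i c, μ (b i ⁻¹' {c}) = 1 / 2

theorem IsFairCoin.measureReal_agree (hb : IsFairCoin b μ) (s t : ℕ) (c : ℕ → Bool) :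
    μ.real {ω | ∀ i ∈ Finset.Ico s t, b i ω = c i} = (1 / 2) ^ (t - s) := by
  have h := hb.indep.measure_inter_preimage_eq_mul (Finset.Ico s t) (sets := fun i => {c i})
    fun i _ => measurableSet_singleton _
  simp only [hb.fair, Finset.prod_const, Nat.card_Ico] at h
  have he : {ω | ∀ i ∈ Finset.Ico s t, b i ω = c i} = ⋂ i ∈ Finset.Ico s t, b i ⁻¹' {c i} := by
    ext ω; simp
  rw [measureReal_def, he, h]
  simp

theorem measurableSet_agree (hb : ∀ i, Measurable (b i)) (s t : ℕ) (c : ℕ → Bool) :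
    MeasurableSet {ω | ∀ i ∈ Finset.Ico s t, b i ω = c i} := by
  have he : {ω | ∀ i ∈ Finset.Ico s t, b i ω = c i} = ⋂ i ∈ Finset.Ico s t, b i ⁻¹' {c i} := by
    ext ω; simp
  rw [he]
  exact Finset.measurableSet_biInter _ fun i _ => hb i (measurableSet_singleton _)

theorem integrable_word [IsFiniteMeasure μ] (hb : ∀ i, Measurable (b i)) (l t : ℕ)
    (F : List Bool → ℝ) : Integrable (fun ω => F (word (fun i => b i ω) t l)) μ := by
  induction l generalizing t F with
  | zero => simp [word]
  | succ l ih =>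
    have hm : ∀ c, MeasurableSet (b t ⁻¹' {c}) := fun c => hb t (measurableSet_singleton _)
    have h1 := ((ih (t + 1) fun w => F (true :: w)).indicator (hm true)).add
      ((ih (t + 1) fun w => F (false :: w)).indicator (hm false))
    refine h1.congr (Eventually.of_forall fun ω => ?_)
    cases h : b t ω <;> simp [Set.indicator, word, h]

theorem IsFairCoin.setIntegral_word [IsFiniteMeasure μ] (hb : IsFairCoin b μ) (l s t : ℕ)
    (hst : s ≤ t) (c : ℕ → Bool) (F : List Bool → ℝ) :
    ∫ ω in {ω | ∀ i ∈ Finset.Ico s t, b i ω = c i}, F (word (fun i => b i ω) t l) ∂μ =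
      (1 / 2) ^ (t - s) * avg l F := by
  induction l generalizing t c F with
  | zero =>
    simp only [word, avg, setIntegral_const, hb.measureReal_agree, smul_eq_mul]
  | succ l ih =>
    -- split according to the toss at time `t`
    have hiff : ∀ x ω, (∀ i ∈ Finset.Ico s (t + 1), b i ω = Function.update c t x i) ↔
        (∀ i ∈ Finset.Ico s t, b i ω = c i) ∧ b t ω = x := by
      intro x ω
      constructor
      · intro h
        refine ⟨fun i hi => ?_, ?_⟩
        · rw [Finset.mem_Ico] at hi
          rw [h i (Finset.mem_Ico.2 (by omega)), Function.update_of_ne (by omega)]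
        · rw [h t (Finset.mem_Ico.2 (by omega)), Function.update_self]
      · rintro ⟨h1, h2⟩ i hi
        rw [Finset.mem_Ico] at hi
        by_cases hit : i = t
        · subst hit; rw [Function.update_self, h2]
        · rw [Function.update_of_ne hit, h1 i (Finset.mem_Ico.2 (by omega))]
    have hset : {ω | ∀ i ∈ Finset.Ico s t, b i ω = c i} =
        {ω | ∀ i ∈ Finset.Ico s (t + 1), b i ω = Function.update c t true i} ∪
        {ω | ∀ i ∈ Finset.Ico s (t + 1), b i ω = Function.update c t false i} := by
      ext ω
      simp only [Set.mem_union, Set.mem_ofPred_eq, hiff]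
      cases b t ω <;> simp
    have hdisj : Disjoint {ω | ∀ i ∈ Finset.Ico s (t + 1), b i ω = Function.update c t true i}
        {ω | ∀ i ∈ Finset.Ico s (t + 1), b i ω = Function.update c t false i} := by
      rw [Set.disjoint_left]
      intro ω h1 h2
      have h1' := ((hiff true ω).1 h1).2
      have h2' := ((hiff false ω).1 h2).2
      rw [h1'] at h2'
      exact Bool.noConfusion h2'
    have hpart : ∀ x, ∫ ω in {ω | ∀ i ∈ Finset.Ico s (t + 1), b i ω = Function.update c t x i},
        F (word (fun i => b i ω) t (l + 1)) ∂μ =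
        (1 / 2) ^ (t + 1 - s) * avg l (fun w => F (x :: w)) := by
      intro x
      rw [← ih (t + 1) (by omega) (Function.update c t x) fun w => F (x :: w)]
      refine setIntegral_congr_fun (measurableSet_agree hb.measurable _ _ _) fun ω hω => ?_
      have := ((hiff x ω).1 hω).2
      simp only [word, this]
    have hint := integrable_word (μ := μ) hb.measurable (l + 1) t F
    rw [hset, setIntegral_union hdisj (measurableSet_agree hb.measurable _ _ _)
      hint.integrableOn hint.integrableOn, hpart, hpart, avg, show t + 1 - s = t - s + 1 by omega,
      pow_succ]
    ring

theorem IsFairCoin.integral_word [IsFiniteMeasure μ] (hb : IsFairCoin b μ) (l t : ℕ)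
    (F : List Bool → ℝ) : ∫ ω, F (word (fun i => b i ω) t l) ∂μ = avg l F := by
  simpa using hb.setIntegral_word l t t le_rfl (fun _ => true) F

/-- Markov's inequality for a function of a word of tosses. -/
theorem IsFairCoin.measureReal_word_ge_le [IsFiniteMeasure μ] (hb : IsFairCoin b μ) (l t : ℕ)
    {F : List Bool → ℝ} (hF : ∀ w, 0 ≤ F w) {r : ℝ} (hr : 0 < r) :
    μ.real {ω | r ≤ F (word (fun i => b i ω) t l)} ≤ avg l F / r := by
  have h := mul_meas_ge_le_integral_of_nonneg (μ := μ)
    (f := fun ω => F (word (fun i => b i ω) t l))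
    (Eventually.of_forall fun ω => hF _) (integrable_word hb.measurable l t F) r
  rw [hb.integral_word] at h
  rw [le_div_iff₀ hr]
  linarith

/-- The walk makes no crossing of height `m` before time `N` with probability at most
`(m ^ 2 + m) / (N + 1)`. -/
theorem IsFairCoin.measureReal_no_crossing_le [IsFiniteMeasure μ] (hb : IsFairCoin b μ) {m : ℤ}
    (hm : 0 < m) (N : ℕ) :
    μ.real {ω | ¬ ∃ s l, s + l ≤ N ∧ IsCrossing (fun i => b i ω) m s l} ≤
      ((m : ℝ) ^ 2 + m) / (N + 1) := by
  refine le_trans (measureReal_mono (fun ω hω => ?_)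
    (measure_ne_top _ _)) ((hb.measureReal_word_ge_le N 0
      (fun w => (stayWeight_mem m 0 w).1) one_pos).trans ?_)
  · have hno : ∀ i j, i ≤ j → j ≤ N →
        height (fun i => b i ω) j - height (fun i => b i ω) i < m := by
      intro i j hij hj
      by_contra hcon
      exact hω (exists_isCrossing _ hm hij hj (not_lt.1 hcon))
    refine (stayWeight_word_eq_one _ m N 0 0 ?_ ?_).ge
    · intro j hj
      simpa using hno 0 j (by omega) hj
    · intro i j hij hj
      simpa using hno i j hij hj
  · rw [div_one]
    exact avg_stayWeight_le m hm.le N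

/-- A union bound over all starting times and lengths: with high probability each crossing
weighs little. -/
theorem IsFairCoin.measureReal_exists_crossWeight_ge_le [IsFiniteMeasure μ]
    (hb : IsFairCoin b μ) {β : ℝ} (hβ : 0 ≤ β) (k n : ℕ) {r : ℝ} (hr : 0 < r) :
    μ.real {ω | ∃ s l, s + l ≤ n ∧ r ≤ crossWeight β k (word (fun i => b i ω) s l)} ≤
      (n + 1) * (green n (crossWeight β k) / r) := by
  calc _ ≤ μ.real (⋃ s ∈ Finset.range (n + 1), ⋃ l ∈ Finset.range (n + 1),
        {ω | r ≤ crossWeight β k (word (fun i => b i ω) s l)}) := by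
        refine measureReal_mono (fun ω hω => ?_) (measure_ne_top _ _)
        obtain ⟨s, l, hsl, h⟩ := hω
        simp only [Set.mem_iUnion, Finset.mem_range]
        exact ⟨s, by omega, l, by omega, h⟩
    _ ≤ ∑ s ∈ Finset.range (n + 1), ∑ l ∈ Finset.range (n + 1),
        μ.real {ω | r ≤ crossWeight β k (word (fun i => b i ω) s l)} :=
        (measureReal_biUnion_finset_le _ _).trans
          (Finset.sum_le_sum fun s _ => measureReal_biUnion_finset_le _ _)
    _ ≤ ∑ s ∈ Finset.range (n + 1), ∑ l ∈ Finset.range (n + 1), avg l (crossWeight β k) / r :=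
        Finset.sum_le_sum fun s _ => Finset.sum_le_sum fun l _ =>
          hb.measureReal_word_ge_le l s (crossWeight_nonneg hβ k) hr
    _ = _ := by
        rw [← Finset.sum_div, Finset.sum_const, Finset.card_range, nsmul_eq_mul]
        push_cast
        rfl

end Coins

/-! ### Elementary properties of `LIS` and of the simple random walk -/

theorem card_le_LIS {s : ℕ → ℤ} {n : ℕ} {A : Finset ℕ} (hA : A ⊆ Finset.range n)
    (h : MonotoneOn s (A : Set ℕ)) : A.card ≤ LIS s n :=
  (isGreatest_LIS s n).2 ⟨A, hA, h, rfl⟩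

theorem LIS_congr {s t : ℕ → ℤ} {n : ℕ} (h : ∀ k < n, s k = t k) : LIS s n = LIS t n := by
  have key : ∀ {s t : ℕ → ℤ}, (∀ k < n, s k = t k) → LIS s n ≤ LIS t n := by
    intro s t h
    obtain ⟨A, hA, hm, hc⟩ := (isGreatest_LIS s n).1
    rw [← hc]
    refine card_le_LIS hA fun i hi j hj hij => ?_
    rw [← h i (Finset.mem_range.1 (hA hi)), ← h j (Finset.mem_range.1 (hA hj))]
    exact hm hi hj hij
  exact le_antisymm (key h) (key fun k hk => (h k hk).symm)

theorem LIS_le (s : ℕ → ℤ) (n : ℕ) : LIS s n ≤ n := by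
  obtain ⟨A, hA, -, hc⟩ := (isGreatest_LIS s n).1
  rw [← hc]
  simpa using Finset.card_le_card hA

theorem measurable_LIS {Ω : Type*} [MeasurableSpace Ω] {S : ℕ → Ω → ℤ}
    (hS : ∀ k, Measurable (S k)) (n : ℕ) : Measurable fun ω => LIS (fun k => S k ω) n := by
  have h1 : Measurable fun (f : Fin n → ℤ) => LIS (fun k => if h : k < n then f ⟨k, h⟩ else 0) n :=
    measurable_of_countable _
  have h2 : Measurable fun ω (i : Fin n) => S i ω := measurable_pi_lambda _ fun i => hS i
  convert h1.comp h2 using 2 with ω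
  refine LIS_congr fun k hk => ?_
  simp [hk]

/-- A simple random walk is almost surely driven by independent fair coins. -/
theorem exists_isFairCoin {Ω : Type*} [MeasurableSpace Ω] {μ : Measure Ω} [IsProbabilityMeasure μ]
    {S : ℕ → Ω → ℤ} (hS : IsSimpleRandomWalk S μ) :
    ∃ b : ℕ → Ω → Bool, IsFairCoin b μ ∧ ∀ᵐ ω ∂μ, ∀ n, S n ω = height (fun i => b i ω) n := by
  obtain ⟨X, hX, hind, hlaw, hsum⟩ := hS
  have hφ : Measurable fun x : ℤ => decide (x = 1) := measurable_of_countable _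
  have htrue : ∀ i, μ ((fun ω => decide (X i ω = 1)) ⁻¹' {true}) = 1 / 2 := fun i => by
    rw [← (hlaw i).1]; congr 1; ext ω; simp
  refine ⟨fun i ω => decide (X i ω = 1), ⟨fun i => hφ.comp (hX i), hind.comp _ fun _ => hφ, ?_⟩, ?_⟩
  · intro i c
    cases c with
    | true => exact htrue i
    | false =>
      have hc : (fun ω => decide (X i ω = 1)) ⁻¹' {false} =
          ((fun ω => decide (X i ω = 1)) ⁻¹' {true})ᶜ := by
        ext ω; simp
      have hm : MeasurableSet ((fun ω => decide (X i ω = 1)) ⁻¹' {true}) :=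
        (hφ.comp (hX i)) (measurableSet_singleton _)
      rw [hc, prob_compl_eq_one_sub hm, htrue]
      simp
  · have hae : ∀ i, ∀ᵐ ω ∂μ, X i ω = 1 ∨ X i ω = -1 := by
      intro i
      have hm : ∀ z, MeasurableSet {ω | X i ω = z} := fun z => hX i (measurableSet_singleton z)
      have hu : μ ({ω | X i ω = 1} ∪ {ω | X i ω = -1}) = 1 := by
        rw [measure_union _ (hm _), (hlaw i).1, (hlaw i).2, ENNReal.add_halves]
        rw [Set.disjoint_left]
        intro ω h1 h2
        simp only [Set.mem_ofPred_eq] at h1 h2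
        omega
      exact (prob_compl_eq_zero_iff ((hm _).union (hm _))).2 hu
    filter_upwards [ae_all_iff.2 hae] with ω hω n
    rw [hsum, height]
    refine Finset.sum_congr rfl fun i _ => ?_
    rcases hω i with h | h <;> simp [step, h]

/-! ### The lower tail of the longest increasing subsequence -/

/-- The crossings are weighted with `β = exp (-1 / 2 ^ k)`. The resulting gain per unit
of `2 ^ k` in `green_crossWeight_le_exp` is raised to the power `2 ^ 4` by doubling the height
four more times, which is enough to beat the number of possible starting times. -/
theorem IsFairCoin.measureReal_LIS_lt_le {Ω : Type*} [MeasurableSpace Ω] {μ : Measure Ω}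
    [IsFiniteMeasure μ] {b : ℕ → Ω → Bool} (hb : IsFairCoin b μ) {K : ℕ} (hK : 4 ≤ K) {n : ℕ}
    (hn : 0 < n) :
    μ.real {ω | (LIS (height fun i => b i ω) n : ℝ) < K * 2 ^ K / 32} ≤
      ((2 ^ K) ^ 2 + 2 ^ K) / n + n * Real.exp (12 - 3 / 2 * K) / 2 ^ (K + 1) := by
  obtain ⟨k, rfl⟩ := Nat.exists_eq_add_of_le' hK
  obtain ⟨N, rfl⟩ := Nat.exists_eq_add_of_le' (Nat.succ_le_of_lt hn)
  set r : ℝ := 1 / 2 ^ k with hr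
  set K : ℕ := k + 4 with hKk
  have hr0 : 0 ≤ r := by positivity
  have hβ1 : Real.exp (-r) ≤ 1 := Real.exp_le_one_iff.2 (by linarith)
  have hrk : r * 2 ^ k = 1 := by rw [hr]; field_simp
  have hra : r * (K * 2 ^ K / 32) = K / 2 := by
    rw [hKk, pow_add]
    linear_combination ((k + 4 : ℕ) : ℝ) / 2 * hrk
  have h1 := hb.measureReal_no_crossing_le (m := 2 ^ K) (by positivity) N
  have h2 := hb.measureReal_exists_crossWeight_ge_le (Real.exp_pos (-r)).le K N
    (Real.exp_pos (-(K / 2)))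
  have hsub : {ω | (LIS (height fun i => b i ω) (N + 1) : ℝ) < K * 2 ^ K / 32} ⊆
      {ω | ¬ ∃ s l, s + l ≤ N ∧ IsCrossing (fun i => b i ω) (2 ^ K) s l} ∪
      {ω | ∃ s l, s + l ≤ N ∧ Real.exp (-(K / 2)) ≤
        crossWeight (Real.exp (-r)) K (word (fun i => b i ω) s l)} := by
    intro ω hω
    by_cases hc : ∃ s l, s + l ≤ N ∧ IsCrossing (fun i => b i ω) (2 ^ K) s l
    · right
      obtain ⟨s, l, hsl, hcr⟩ := hc
      obtain ⟨A, hA, hmono, -, hw⟩ :=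
        exists_monotoneOn_of_isCrossing _ (Real.exp_pos (-r)).le K s l hcr
      refine ⟨s, l, hsl, le_trans ?_ hw⟩
      have hcard : A.card ≤ LIS (height fun i => b i ω) (N + 1) := by
        refine card_le_LIS (fun i hi => ?_) hmono
        have := hA hi
        simp only [Finset.mem_Ico, Finset.mem_range] at this ⊢
        omega
      have hcard' : (A.card : ℝ) ≤ K * 2 ^ K / 32 :=
        le_trans (by exact_mod_cast hcard) (le_of_lt hω)
      rw [← Real.exp_nat_mul, Real.exp_le_exp, ← hra]
      nlinarith
    · exact Or.inl hc
  have hgreen : green N (crossWeight (Real.exp (-r)) K) ≤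
      Real.exp (12 - 2 * K) / 2 ^ (K + 1) := by
    refine (green_crossWeight_add_le (Real.exp_pos _).le hβ1 k N
      (green_crossWeight_le_exp hr0 k N hrk.le) 4).trans ?_
    refine div_le_div_of_nonneg_right (Real.exp_le_exp.2 ?_) (by positivity)
    rw [show r * (2 ^ k * ((k : ℝ) / 8 - 1 / 4) + 1 / 4) =
      (r * 2 ^ k) * ((k : ℝ) / 8 - 1 / 4) + r / 4 by ring, hrk, hKk]
    push_cast
    linarith
  refine (measureReal_mono hsub (measure_ne_top _ _)).trans ((measureReal_union_le _ _).trans ?_)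
  refine add_le_add (h1.trans (le_of_eq (by push_cast; rfl))) (h2.trans ?_)
  calc ((N : ℝ) + 1) * (green N (crossWeight (Real.exp (-r)) K) / Real.exp (-(K / 2)))
      ≤ ((N : ℝ) + 1) * (Real.exp (12 - 2 * K) / 2 ^ (K + 1) / Real.exp (-(K / 2))) := by gcongr
    _ = ((N : ℝ) + 1) * (Real.exp (12 - 2 * K - -(K / 2)) / 2 ^ (K + 1)) := by
        rw [Real.exp_sub (12 - 2 * (K : ℝ))]; ring
    _ = _ := by
        rw [show (12 : ℝ) - 2 * K - -(K / 2) = 12 - 3 / 2 * K by ring]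
        push_cast
        ring

/-- The height `2 ^ K` of the crossings is chosen in the interval `(80 ε √n, 160 ε √n]`. -/
theorem eventually_exists_scale {ε : ℝ} (hε : 0 < ε) (hε1 : ε < 1 / 250) :
    ∀ᶠ n : ℕ in atTop, 0 < n ∧ ∃ K : ℕ, 4 ≤ K ∧
      ε * √(n : ℝ) * Real.logb 2 n ≤ K * 2 ^ K / 32 ∧
      ((2 ^ K) ^ 2 + 2 ^ K) / n + n * Real.exp (12 - 3 / 2 * K) / 2 ^ (K + 1) ≤ 250 * ε := by
  have hlog : Tendsto (fun n : ℕ => Real.logb 2 n) atTop atTop :=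
    (Real.tendsto_logb_atTop (by norm_num)).comp tendsto_natCast_atTop_atTop
  have hsqrt : Tendsto (fun n : ℕ => √(n : ℝ)) atTop atTop :=
    Real.tendsto_sqrt_atTop.comp tendsto_natCast_atTop_atTop
  have hexp : Tendsto (fun n : ℕ => Real.exp (12 - 1 / 5 * Real.logb 2 n)) atTop (nhds 0) := by
    refine Real.tendsto_exp_atBot.comp ?_
    exact tendsto_atBot_add_const_left _ 12 (tendsto_neg_atTop_atBot.comp
      (hlog.const_mul_atTop (by norm_num : (0 : ℝ) < 1 / 5)))
  have hc : 0 < 12800 * ε ^ 3 := by positivity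
  filter_upwards [eventually_gt_atTop 0, hlog.eventually_ge_atTop (-10 * Real.logb 2 (80 * ε)),
    hlog.eventually_ge_atTop 10, hsqrt.eventually_ge_atTop 160,
    hsqrt.eventually_ge_atTop (1 / (80 * ε)), hexp.eventually (eventually_le_nhds hc)]
    with n hn h1 h2 h3 h4 h5
  refine ⟨hn, ?_⟩
  set q := √(n : ℝ) with hq
  set L := Real.logb 2 n with hL
  have hq0 : 0 < q := by linarith
  have hqn : (n : ℝ) = q ^ 2 := (Real.sq_sqrt (Nat.cast_nonneg n)).symm
  have hx1 : 1 ≤ 80 * ε * q := by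
    rw [div_le_iff₀ (by positivity)] at h4
    linarith
  obtain ⟨j, hj1, hj2⟩ := exists_nat_pow_near hx1 (by norm_num : (1 : ℝ) < 2)
  have hup : (2 : ℝ) ^ (j + 1) ≤ 160 * ε * q := by rw [pow_succ]; linarith
  generalize j + 1 = K at hj2 hup
  have hP : (0 : ℝ) < 2 ^ K := by positivity
  have hKL : 2 / 5 * L ≤ K := by
    have e1 : Real.logb 2 (80 * ε * q) < K := by
      rw [Real.logb_lt_iff_lt_rpow (by norm_num) (by positivity), Real.rpow_natCast]
      exact hj2
    have e2 : Real.logb 2 q = L / 2 := by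
      rw [hL, hqn, Real.logb_pow]; push_cast; ring
    rw [Real.logb_mul (by positivity) hq0.ne', e2] at e1
    linarith
  refine ⟨K, ?_, ?_, ?_⟩
  · have : (4 : ℝ) ≤ K := by linarith
    exact_mod_cast this
  · have : 2 / 5 * L * (80 * ε * q) ≤ K * 2 ^ K := by gcongr
    linarith
  · have t1 : (((2 : ℝ) ^ K) ^ 2 + 2 ^ K) / n ≤ 104 * ε := by
      rw [hqn, div_le_iff₀ (by positivity)]
      have a1 : ((2 : ℝ) ^ K) ^ 2 ≤ (160 * ε * q) ^ 2 := by gcongr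
      have a2 : 160 * ε * q ≤ ε * q ^ 2 := by
        have := mul_le_mul_of_nonneg_left h3 (mul_pos hε hq0).le
        linarith
      have a3 : (160 * ε * q) ^ 2 ≤ 103 * ε * q ^ 2 := by
        have : ε * (ε * q ^ 2) ≤ 1 / 250 * (ε * q ^ 2) := by gcongr
        nlinarith
      linarith
    have t2 : (n : ℝ) * Real.exp (12 - 3 / 2 * K) / 2 ^ (K + 1) ≤ ε := by
      have b1 : (2 : ℝ) ^ K ≤ Real.exp K := by
        rw [← Real.exp_one_pow]
        exact pow_le_pow_left₀ (by norm_num) (by linarith [Real.add_one_le_exp (1 : ℝ)]) K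
      have b2 : (n : ℝ) ≤ (2 ^ K) ^ 2 / (6400 * ε ^ 2) := by
        rw [le_div_iff₀ (by positivity), hqn]
        calc q ^ 2 * (6400 * ε ^ 2) = (80 * ε * q) ^ 2 := by ring
          _ ≤ (2 ^ K) ^ 2 := by gcongr
      have b3 : Real.exp (12 - 3 / 2 * K) * Real.exp K ≤ 12800 * ε ^ 3 := by
        rw [← Real.exp_add]
        refine le_trans (Real.exp_le_exp.2 ?_) h5
        linarith
      calc (n : ℝ) * Real.exp (12 - 3 / 2 * K) / 2 ^ (K + 1)
          ≤ (2 ^ K) ^ 2 / (6400 * ε ^ 2) * Real.exp (12 - 3 / 2 * K) / 2 ^ (K + 1) := by gcongr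
        _ = Real.exp (12 - 3 / 2 * K) * 2 ^ K / (12800 * ε ^ 2) := by
            rw [pow_succ]; field_simp; ring
        _ ≤ Real.exp (12 - 3 / 2 * K) * Real.exp K / (12800 * ε ^ 2) := by gcongr
        _ ≤ 12800 * ε ^ 3 / (12800 * ε ^ 2) := by gcongr
        _ = ε := by field_simp
    linarith

theorem eventually_measureReal_LIS_lt_le {Ω : Type*} [MeasurableSpace Ω] {μ : Measure Ω}
    [IsProbabilityMeasure μ] {S : ℕ → Ω → ℤ} (hS : IsSimpleRandomWalk S μ) {ε : ℝ} (hε : 0 < ε) :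
    ∀ᶠ n : ℕ in atTop,
      μ.real {ω | (LIS (fun k => S k ω) n : ℝ) < ε * √(n : ℝ) * Real.logb 2 n} ≤ 250 * ε := by
  rcases le_or_gt (1 / 250) ε with hbig | hsmall
  · exact Eventually.of_forall fun n => measureReal_le_one.trans (by linarith)
  obtain ⟨b, hb, hSb⟩ := exists_isFairCoin hS
  filter_upwards [eventually_exists_scale hε hsmall] with n ⟨hn, K, hK, hlen, hprob⟩
  refine le_trans ?_ ((hb.measureReal_LIS_lt_le hK hn).trans hprob)
  refine ENNReal.toReal_mono (measure_ne_top _ _) (measure_mono_ae ?_)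
  filter_upwards [hSb] with ω hω hlt
  have heq : (fun k => S k ω) = height fun i => b i ω := funext hω
  have hlt' : (LIS (fun k => S k ω) n : ℝ) < ε * √(n : ℝ) * Real.logb 2 n := hlt
  rw [heq] at hlt'
  exact hlt'.trans_le hlen

end CoinWalk

theorem mainTheorem2 {Ω : Type*} [MeasurableSpace Ω] (μ : Measure Ω) [IsProbabilityMeasure μ]
    (S : ℕ → Ω → ℤ) (hS : IsSimpleRandomWalk S μ) :
    (∀ ε : ℝ, 0 < ε → ∀ᶠ n : ℕ in atTop,
      μ.real {ω | (LIS (fun k => S k ω) n : ℝ) < ε * √(n : ℝ) * Real.logb 2 n} ≤ 250 * ε) ∧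
    (∀ᶠ n : ℕ in atTop,
      (1 / 1000 : ℝ) * √(n : ℝ) * Real.logb 2 n ≤ ∫ ω, (LIS (fun k => S k ω) n : ℝ) ∂μ) := by
  have htail := fun (ε : ℝ) (hε : 0 < ε) => CoinWalk.eventually_measureReal_LIS_lt_le hS hε
  refine ⟨htail, ?_⟩
  have hSm : ∀ k, Measurable (S k) := by
    obtain ⟨X, hX, -, -, hsum⟩ := hS
    intro k
    rw [show S k = fun ω => ∑ i ∈ Finset.range k, X i ω from funext (hsum k)]
    exact Finset.measurable_fun_sum _ fun i _ => hX i
  -- for `ε = 1 / 500` the tail bound is `1 / 2`, and Markov's inequality gives the constant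
  -- `1 / 500 * 1 / 2`
  filter_upwards [htail (1 / 500) (by norm_num), eventually_ge_atTop 1] with n hn hn1
  have hmeas : Measurable fun ω => (LIS (fun k => S k ω) n : ℝ) :=
    measurable_from_top.comp (CoinWalk.measurable_LIS hSm n)
  have hint : Integrable (fun ω => (LIS (fun k => S k ω) n : ℝ)) μ :=
    Integrable.of_bound hmeas.aestronglyMeasurable n (Eventually.of_forall fun ω => by
      rw [Real.norm_natCast]
      exact_mod_cast CoinWalk.LIS_le _ n)
  set c : ℝ := 1 / 500 * √(n : ℝ) * Real.logb 2 n with hc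
  have hc0 : 0 ≤ c := mul_nonneg (by positivity)
    (Real.logb_nonneg (by norm_num) (by exact_mod_cast hn1))
  have hmarkov := mul_meas_ge_le_integral_of_nonneg (μ := μ)
    (Eventually.of_forall fun ω => Nat.cast_nonneg (LIS (fun k => S k ω) n)) hint c
  have hcompl : μ.real {ω | c ≤ (LIS (fun k => S k ω) n : ℝ)} =
      1 - μ.real {ω | (LIS (fun k => S k ω) n : ℝ) < c} := by
    rw [← probReal_compl_eq_one_sub (measurableSet_lt hmeas measurable_const)]
    congr 1
    ext ω
    simp
  rw [hcompl] at hmarkov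
  calc (1 / 1000 : ℝ) * √(n : ℝ) * Real.logb 2 n = c * (1 / 2) := by rw [hc]; ring
    _ ≤ c * (1 - μ.real {ω | (LIS (fun k => S k ω) n : ℝ) < c}) :=
        mul_le_mul_of_nonneg_left (by linarith) hc0
    _ ≤ _ := hmarkov
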